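/- **Definitions.** Let $A$ be a unital $C^*$-algebra with state space $\mathcal S(A)$ (the positive linear functionals $\mu$ on $A$ with $\mu(1)=1$). A *Lipschitz seminorm* on $A$ is a map $L:A\to[0,\infty]$ with $L(a+b)\le L(a)+L(b)$, $L(ca)=|c|\,L(a)$ for $c\in\mathbb C$ (with $0\cdot\infty=0$), $L(a^*)=L(a)$, such that $L(a)=0$ if and only if $a\in\mathbb C1$, and such that $\{a\in A: L(a)<\infty\}$ is dense in $A$. It is a *Lip-norm* if the topology on $\mathcal S(A)$ induced by $$\rho_L(\mu,\nu)=\sup\{|\mu(a)-\nu(a)| : a\in A,\ L(a)\le 1\}$$ is the weak$^*$-topology. The algebra $A$ *admits a compact quantum metric space structure* if there is a Lip-norm on $A$. An *inductive limit* of unital $C^*$-algebras $B_n$ along unital $*$-homomorphisms $\varphi_n:B_n\to B_{n+1}$ ($n\ge 0$) is their $C^*$-algebraic inductive limit; that is, a unital $C^*$-algebra $A$ with unital $*$-homomorphisms $\psi_n:B_n\to A$ such that $\psi_{n+1}\circ\varphi_n=\psi_n$, $\bigcup_n\psi_n(B_n)$ is dense in $A$, and $\|\psi_n(x)\|=\lim_{j\to\infty}\|\varphi_{n+j-1}\circ\cdots\circ\varphi_n(x)\|$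 for all $n$ and $x\in B_n$. * A *UHF algebra* is an inductive limit of full matrix algebras $M_{k_n}(\mathbb C)$, $k_n\ge 1$, along unital $*$-homomorphisms. * A *unital AF algebra* is a unital $C^*$-algebra that is the closure of the union of an increasing sequence of finite-dimensional $*$-subalgebras (not required to contain the unit). * A *Bunce–Deddens algebra* is an inductive limit of $M_{k_n}(C(\mathbb T))$, where $k_0\ge1$, $k_{n+1}=k_nm_n$ with $m_n\ge 2$, along the connecting maps $$M_{k_n}(C(\mathbb T))\to M_{k_n}\bigl(M_{m_n}(C(\mathbb T))\bigr)\cong M_{k_{n+1}}(C(\mathbb T)),\qquad (f_{pq})\mapsto (f_{pq}(v_{m_n})),$$ where $f\mapsto f(v_m)$ is the unital $*$-homomorphism $C(\mathbb T)\to M_m(C(\mathbb T))$ that sends the coordinate function $z$ to the unitary $v_m$ given by $v_me_j=e_{j+1}$ for $0\le j<m-1$ and $v_me_{m-1}=z\,e_0$. **Corollary 3.7.** Every UHF algebra, every unital AF algebra and every Bunce–Deddens algebra admits a compact quantum metric space structure. -/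

import Mathlib

open scoped ENNReal Topology ComplexOrder

noncomputable section

namespace QuantumMetric

universe u v

/-! ### State spaces and Lip-norms -/

/-- The state space of a unital C*-algebra: the positive linear functionals `μ` with `μ 1 = 1`,
with the (subspace topology of the) weak-* topology. -/
abbrev StateSpace (A : Type u) [CStarAlgebra A] : Type u :=
  {μ : WeakDual ℂ A // μ 1 = 1 ∧ ∀ a : A, 0 ≤ μ (star a * a)}

/-- A Lipschitz seminorm: a seminorm that may take the value `∞` (with `0 * ∞ = 0`), is
`*`-invariant, vanishes exactly on the scalars, and is finite on a dense set. -/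
structure IsLipschitzSeminorm {A : Type u} [CStarAlgebra A] (L : A → ℝ≥0∞) : Prop where
  add_le : ∀ a b : A, L (a + b) ≤ L a + L b
  smul_eq : ∀ (c : ℂ) (a : A), L (c • a) = ‖c‖ₑ * L a
  star_eq : ∀ a : A, L (star a) = L a
  eq_zero_iff : ∀ a : A, L a = 0 ↔ ∃ c : ℂ, a = algebraMap ℂ A c
  dense_dom : Dense {a : A | L a < ∞}

/-- The Monge-Kantorovich (extended) distance
`ρ_L(μ, ν) = sup {|μ(a) - ν(a)| : L(a) ≤ 1}` on the state space. -/
def mongeKantorovich {A : Type u} [CStarAlgebra A] (L : A → ℝ≥0∞) (μ ν : StateSpace A) : ℝ≥0∞ :=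
  ⨆ (a : A) (_ : L a ≤ 1), ‖μ.1 a - ν.1 a‖ₑ

/-- The Monge-Kantorovich distance as an extended (pseudo)metric; the topology of this structure
is generated by the balls `{ν | ρ_L(ν, μ) < ε}`. -/
@[reducible] def mongeKantorovichSpace {A : Type u} [CStarAlgebra A] (L : A → ℝ≥0∞) :
    PseudoEMetricSpace (StateSpace A) where
  edist := mongeKantorovich L
  edist_self μ := by simp [mongeKantorovich]
  edist_comm μ ν := by
    simp only [mongeKantorovich]
    refine iSup_congr fun a => iSup_congr fun _ => ?_
    rw [← enorm_neg, neg_sub]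
  edist_triangle μ ν κ := by
    refine iSup₂_le fun a ha => ?_
    calc ‖μ.1 a - κ.1 a‖ₑ = ‖(μ.1 a - ν.1 a) + (ν.1 a - κ.1 a)‖ₑ := by
          rw [sub_add_sub_cancel]
      _ ≤ ‖μ.1 a - ν.1 a‖ₑ + ‖ν.1 a - κ.1 a‖ₑ := enorm_add_le _ _
      _ ≤ mongeKantorovich L μ ν + mongeKantorovich L ν κ :=
          add_le_add (le_iSup₂_of_le a ha le_rfl) (le_iSup₂_of_le a ha le_rfl)

/-- A Lip-norm: a Lipschitz seminorm whose Monge-Kantorovich metric induces the weak-* topology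
on the state space. -/
structure IsLipNorm {A : Type u} [CStarAlgebra A] (L : A → ℝ≥0∞) : Prop
    extends IsLipschitzSeminorm L where
  topology_eq : (mongeKantorovichSpace L).toUniformSpace.toTopologicalSpace =
    (inferInstance : TopologicalSpace (StateSpace A))

/-- `A` admits the structure of a compact quantum metric space. -/
def AdmitsCompactQuantumMetric (A : Type u) [CStarAlgebra A] : Prop :=
  ∃ L : A → ℝ≥0∞, IsLipNorm L

/-! ### Inductive limits -/

/-- The composed connecting map `B n → B (n + j)` of an inductive sequence. -/
def connect {B : ℕ → Type v} [∀ n, CStarAlgebra (B n)]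
    (φ : ∀ n, B n →⋆ₐ[ℂ] B (n + 1)) (n : ℕ) : ∀ j : ℕ, B n →⋆ₐ[ℂ] B (n + j)
  | 0 => StarAlgHom.id ℂ (B n)
  | j + 1 => (φ (n + j)).comp (connect φ n j)

/-- `A`, with the unital `*`-homomorphisms `ψ n : B n → A`, is the C*-algebra inductive limit of
the inductive sequence `(B n, φ n)` of unital C*-algebras: the `ψ n` are compatible with the
connecting maps, the union of their ranges is dense, and the norm of `ψ n x` is the limit of the
norms of the images of `x` along the sequence. These properties determine `(A, ψ)` up to a unique
`*`-isomorphism. -/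
structure IsInductiveLimit {B : ℕ → Type v} [∀ n, CStarAlgebra (B n)]
    (φ : ∀ n, B n →⋆ₐ[ℂ] B (n + 1)) {A : Type u} [CStarAlgebra A]
    (ψ : ∀ n, B n →⋆ₐ[ℂ] A) : Prop where
  compat : ∀ (n : ℕ) (x : B n), ψ (n + 1) (φ n x) = ψ n x
  dense : Dense (⋃ n, Set.range (ψ n))
  norm_eq : ∀ (n : ℕ) (x : B n),
    Filter.Tendsto (fun j => ‖connect φ n j x‖) Filter.atTop (𝓝 ‖ψ n x‖)

/-! ### UHF and AF algebras -/

/-- UHF algebras: inductive limits of full matrix algebras `M_{k n}(ℂ)`, `k n ≥ 1`, along unital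
`*`-homomorphisms. -/
def IsUHF (A : Type u) [CStarAlgebra A] : Prop :=
  ∃ (k : ℕ → ℕ) (_ : ∀ n, 1 ≤ k n)
    (φ : ∀ n, CStarMatrix (Fin (k n)) (Fin (k n)) ℂ →⋆ₐ[ℂ]
      CStarMatrix (Fin (k (n + 1))) (Fin (k (n + 1))) ℂ)
    (ψ : ∀ n, CStarMatrix (Fin (k n)) (Fin (k n)) ℂ →⋆ₐ[ℂ] A),
    IsInductiveLimit φ ψ

/-- Unital AF algebras: unital C*-algebras that are the closure of the union of an increasing
sequence of finite-dimensional `*`-subalgebras. The subalgebras need not contain the unit of `A`;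
finite-dimensional `*`-subalgebras are automatically closed. -/
def IsAF (A : Type u) [CStarAlgebra A] : Prop :=
  ∃ S : ℕ → NonUnitalStarSubalgebra ℂ A, Monotone S ∧
    (∀ n, FiniteDimensional ℂ (S n)) ∧ Dense (⋃ n, (S n : Set A))

/-! ### Bunce-Deddens algebras -/

/-- The circle algebra `M_k(C(𝕋))`. -/
abbrev CircleMatrix (k : ℕ) : Type := CStarMatrix (Fin k) (Fin k) C(Circle, ℂ)

/-- The function `z ↦ z` in `C(𝕋)`. -/
def circleCoord : C(Circle, ℂ) := ⟨fun z => (z : ℂ), continuous_subtype_val⟩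

/-- The `m × m` matrix over `C(𝕋)` of the cyclic shift with weight `z` at the wrap-around: it
sends the basis vector `e_j` to `e_{j+1}` for `j + 1 < m`, and `e_{m-1}` to `z e_0`. Its `m`-th
power is `z` times the identity. -/
def cyclicShift (m : ℕ) : CircleMatrix m :=
  CStarMatrix.ofMatrix fun i j =>
    if (j : ℕ) + 1 = i then 1 else if (i : ℕ) = 0 ∧ (j : ℕ) + 1 = m then circleCoord else 0

theorem star_circleCoord_mul : star circleCoord * circleCoord = 1 := by
  ext z
  change star (z : ℂ) * (z : ℂ) = 1
  rw [Complex.star_def, ← Complex.normSq_eq_conj_mul_self, Circle.normSq_coe, Complex.ofReal_one]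

theorem cyclicShift_mem_unitary (m : ℕ) : cyclicShift m ∈ unitary (CircleMatrix m) := by
  let V : Matrix (Fin m) (Fin m) C(Circle, ℂ) := cyclicShift m
  have key : star V * V = 1 := by
    ext1 i j
    rw [Matrix.mul_apply]
    simp only [Matrix.star_apply]
    have hV : ∀ i j : Fin m, V i j = if (j : ℕ) + 1 = i then 1 else
        if (i : ℕ) = 0 ∧ (j : ℕ) + 1 = m then circleCoord else 0 := fun _ _ => rfl
    simp only [hV]
    by_cases hj : (j : ℕ) + 1 = m
    · rw [Finset.sum_eq_single (⟨0, by have := j.2; omega⟩ : Fin m)]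
      · by_cases hij : i = j
        · subst hij
          have hm : m ≠ 0 := by have := i.2; omega
          simp [hj, hm, star_circleCoord_mul]
        · have : (i : ℕ) + 1 ≠ m := fun h => hij (Fin.ext (by omega))
          simp [this, Matrix.one_apply_ne hij]
      · intro l _ hl
        have h1 : (l : ℕ) ≠ 0 := fun h => hl (Fin.ext h)
        have h2 : (j : ℕ) + 1 ≠ l := by have := l.2; omega
        simp [h1, h2]
      · simp
    · rw [Finset.sum_eq_single (⟨j + 1, by have := j.2; omega⟩ : Fin m)]
      · by_cases hij : i = j
        · subst hij
          simp
        · have : (i : ℕ) ≠ j := fun h => hij (Fin.ext h)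
          simp [this, Matrix.one_apply_ne hij]
      · intro l _ hl
        have h2 : (j : ℕ) + 1 ≠ l := fun h => hl (Fin.ext h.symm)
        simp [hj, h2]
      · simp
  exact Unitary.mem_iff.mpr ⟨key, (mul_eq_one_comm (a := star V) (b := V)).mp key⟩

/-- The inclusion of the spectrum of `cyclicShift m` into the circle. -/
def spectrumToCircle (m : ℕ) : C(spectrum ℂ (cyclicShift m), Circle) where
  toFun w := ⟨w.1, by
    have h := spectrum.subset_circle_of_unitary (𝕜 := ℂ) (cyclicShift_mem_unitary m) w.2
    simpa [Submonoid.unitSphere] using h⟩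
  continuous_toFun := by
    exact continuous_subtype_val.subtype_mk _

theorem isStarNormal_cyclicShift (m : ℕ) : IsStarNormal (cyclicShift m) :=
  ⟨by
    have h := Unitary.mem_iff.mp (cyclicShift_mem_unitary m)
    rw [Commute, SemiconjBy, h.1, h.2]⟩

/-- The unital `*`-homomorphism `C(𝕋) → M_m(C(𝕋))`, `f ↦ f(v)`, given by continuous functional
calculus at the unitary `v = cyclicShift m`; it is the one that sends `z` to `v`. -/
def shiftCalculus (m : ℕ) : C(Circle, ℂ) →⋆ₐ[ℂ] CircleMatrix m :=
  (cfcHom (R := ℂ) (isStarNormal_cyclicShift m)).comp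
    (ContinuousMap.compStarAlgHom' ℂ ℂ (spectrumToCircle m))

theorem shiftCalculus_circleCoord (m : ℕ) : shiftCalculus m circleCoord = cyclicShift m :=
  cfcHom_id (R := ℂ) (isStarNormal_cyclicShift m)

theorem shiftCalculus_one_entry (k m : ℕ) (p q : Fin (k * m)) :
    shiftCalculus m
      ((1 : CircleMatrix k) (finProdFinEquiv.symm p).1 (finProdFinEquiv.symm q).1)
      (finProdFinEquiv.symm p).2 (finProdFinEquiv.symm q).2 = (1 : CircleMatrix (k * m)) p q := by
  by_cases h1 : (finProdFinEquiv.symm p).1 = (finProdFinEquiv.symm q).1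
  · by_cases h2 : (finProdFinEquiv.symm p).2 = (finProdFinEquiv.symm q).2
    · have : p = q := finProdFinEquiv.symm.injective (Prod.ext h1 h2)
      subst this
      rw [CStarMatrix.one_apply_eq, CStarMatrix.one_apply_eq, map_one,
        CStarMatrix.one_apply_eq]
    · have : p ≠ q := fun h => h2 (by rw [h])
      rw [h1, CStarMatrix.one_apply_eq, CStarMatrix.one_apply_ne this, map_one,
        CStarMatrix.one_apply_ne h2]
  · have : p ≠ q := fun h => h1 (by rw [h])
    rw [CStarMatrix.one_apply_ne h1, CStarMatrix.one_apply_ne this, map_zero]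
    rfl

/-- The standard connecting map `M_k(C(𝕋)) → M_{km}(C(𝕋))`: apply `f ↦ f(v)` to every entry of a
`k × k` matrix over `C(𝕋)` and flatten the resulting `k × k` matrix of `m × m` blocks. -/
def circleConnect (k m : ℕ) : CircleMatrix k →⋆ₐ[ℂ] CircleMatrix (k * m) where
  toFun F := CStarMatrix.ofMatrix fun p q =>
    shiftCalculus m (F (finProdFinEquiv.symm p).1 (finProdFinEquiv.symm q).1)
      (finProdFinEquiv.symm p).2 (finProdFinEquiv.symm q).2
  map_one' := by
    ext1 p q
    exact shiftCalculus_one_entry k m p q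
  map_mul' F G := by
    ext1 p q
    rw [CStarMatrix.mul_apply, ← finProdFinEquiv.sum_comp, Fintype.sum_prod_type]
    change shiftCalculus m ((F * G) _ _) _ _ = _
    rw [CStarMatrix.mul_apply, map_sum]
    simp only [map_mul]
    have hs : ∀ (f : Fin k → CircleMatrix m) (i j : Fin m), (∑ x, f x) i j = ∑ x, f x i j :=
      fun f i j => Matrix.sum_apply i j Finset.univ f
    rw [hs]
    refine Finset.sum_congr rfl fun x _ => ?_
    rw [CStarMatrix.mul_apply]
    refine Finset.sum_congr rfl fun y _ => ?_
    change _ = shiftCalculus m (F _ (finProdFinEquiv.symm (finProdFinEquiv (x, y))).1) _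
        (finProdFinEquiv.symm (finProdFinEquiv (x, y))).2 *
      shiftCalculus m (G (finProdFinEquiv.symm (finProdFinEquiv (x, y))).1 _)
        (finProdFinEquiv.symm (finProdFinEquiv (x, y))).2 _
    rw [Equiv.symm_apply_apply]
  map_zero' := by
    ext1 p q
    change shiftCalculus m 0 _ _ = 0
    rw [map_zero]
    rfl
  map_add' F G := by
    ext1 p q
    change shiftCalculus m (F _ _ + G _ _) _ _ = _
    rw [map_add]
    rfl
  commutes' c := by
    ext1 p q
    change shiftCalculus m (algebraMap ℂ (CircleMatrix k) c _ _) _ _ = _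
    rw [Algebra.algebraMap_eq_smul_one, Algebra.algebraMap_eq_smul_one, CStarMatrix.smul_apply,
      CStarMatrix.smul_apply, map_smul, CStarMatrix.smul_apply]
    exact congrArg (c • ·) (shiftCalculus_one_entry k m p q)
  map_star' F := by
    ext1 p q
    change shiftCalculus m (star (F _ _)) _ _ = star (shiftCalculus m (F _ _) _ _)
    rw [map_star, CStarMatrix.star_apply]

/-- The sizes `k₀, k₀ m₀, k₀ m₀ m₁, …`. -/
def bdSize (k₀ : ℕ) (m : ℕ → ℕ) : ℕ → ℕ
  | 0 => k₀
  | n + 1 => bdSize k₀ m n * m n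

/-- Bunce-Deddens algebras: inductive limits of `M_{k n}(C(𝕋))` along the standard connecting
maps, where `k n` is a strictly increasing sequence of positive integers, each dividing the next
(`k (n + 1) = k n * m n` with `m n ≥ 2`). -/
def IsBunceDeddens (A : Type u) [CStarAlgebra A] : Prop :=
  ∃ (k₀ : ℕ) (m : ℕ → ℕ) (_ : 1 ≤ k₀) (_ : ∀ n, 2 ≤ m n)
    (ψ : ∀ n, CircleMatrix (bdSize k₀ m n) →⋆ₐ[ℂ] A),
    IsInductiveLimit (B := fun n => CircleMatrix (bdSize k₀ m n))
      (fun n => circleConnect (bdSize k₀ m n) (m n)) ψ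

end QuantumMetric

end

/-! Algebras in all three classes are separable, and separability alone suffices. Given a dense
sequence `d` in `A`, the weighted sum `seqDist d` is a weak-* continuous metric on the states, and
`seqLip d a` is the Lipschitz constant of evaluation at `a`. It is finite on every `d n`, because
one term of the sum is controlled by the whole, and it vanishes only on scalars, because states
separate points (`eq_zero_of_states`, via characters and Hahn–Banach).

The topologies agree by two comparisons. The Monge–Kantorovich distance is at most `seqDist d`, so
weak-* convergence implies metric convergence. Conversely, evaluation at any `a` with finite
seminorm is Lipschitz for that distance; such `a` are dense and states are uniformly bounded, so
every evaluation is continuous. Compactness of the state space is not needed. -/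

noncomputable section

namespace QuantumMetric

universe u v

/-! ### States -/

section States

variable {A : Type u} [CStarAlgebra A]

/-- A state takes nonnegative values on elements that are nonnegative in the spectral order. -/
theorem StateSpace.apply_nonneg [PartialOrder A] [StarOrderedRing A] (μ : StateSpace A) {a : A}
    (ha : 0 ≤ a) : 0 ≤ μ.1 a := by
  obtain ⟨b, rfl⟩ := CStarAlgebra.nonneg_iff_eq_star_mul_self.mp ha
  exact μ.2.2 b

/-- A state is real on self-adjoint elements, and bounded there by the norm. -/
theorem StateSpace.exists_real_of_isSelfAdjoint (μ : StateSpace A) {a : A}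
    (ha : IsSelfAdjoint a) : ∃ r : ℝ, μ.1 a = r ∧ |r| ≤ ‖a‖ := by
  let _ := CStarAlgebra.spectralOrder A
  have := CStarAlgebra.spectralOrderedRing A
  have hone : μ.1 (algebraMap ℝ A ‖a‖) = (‖a‖ : ℂ) := by
    rw [IsScalarTower.algebraMap_apply ℝ ℂ A, Algebra.algebraMap_eq_smul_one, map_smul, μ.2.1]
    simp
  have h1 := μ.apply_nonneg (sub_nonneg.mpr (IsSelfAdjoint.le_algebraMap_norm_self ha))
  have h2 := μ.apply_nonneg (neg_le_iff_add_nonneg.mp (IsSelfAdjoint.neg_algebraMap_norm_le_self ha))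
  rw [map_sub, hone] at h1
  rw [map_add, hone] at h2
  rw [Complex.le_def] at h1 h2
  simp only [Complex.zero_re, Complex.zero_im, Complex.sub_re, Complex.sub_im, Complex.add_re,
    Complex.add_im, Complex.ofReal_re, Complex.ofReal_im] at h1 h2
  refine ⟨(μ.1 a).re, Complex.ext (by simp) (by simp; linarith [h1.2]), abs_le.mpr ⟨?_, ?_⟩⟩
  · linarith [h2.1]
  · linarith [h1.1]

/-- States are hermitian. -/
theorem StateSpace.apply_star (μ : StateSpace A) (a : A) : μ.1 (star a) = star (μ.1 a) := by
  obtain ⟨r, hr, -⟩ := μ.exists_real_of_isSelfAdjoint (realPart a).2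
  obtain ⟨s, hs, -⟩ := μ.exists_real_of_isSelfAdjoint (imaginaryPart a).2
  rw [← realPart_add_I_smul_imaginaryPart a]
  simp only [star_add, star_smul, map_add, map_smul, hr, hs, (realPart a).2.star_eq,
    (imaginaryPart a).2.star_eq]
  simp

/-- The factor 2 comes from bounding real and imaginary parts separately. The sharp constant 1 is
not needed, only a bound uniform over states. -/
theorem StateSpace.norm_apply_le (μ : StateSpace A) (a : A) : ‖μ.1 a‖ ≤ 2 * ‖a‖ := by
  obtain ⟨r, hr, hr'⟩ := μ.exists_real_of_isSelfAdjoint (realPart a).2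
  obtain ⟨s, hs, hs'⟩ := μ.exists_real_of_isSelfAdjoint (imaginaryPart a).2
  have h1 : ‖(realPart a : A)‖ ≤ ‖a‖ := realPart.norm_le a
  have h2 : ‖(imaginaryPart a : A)‖ ≤ ‖a‖ := imaginaryPart.norm_le a
  have : μ.1 a = r + Complex.I * s := by
    conv_lhs => rw [← realPart_add_I_smul_imaginaryPart a]
    rw [map_add, map_smul, hr, hs, smul_eq_mul]
  rw [this]
  refine (norm_add_le _ _).trans ?_
  rw [norm_mul, Complex.norm_I, one_mul, Complex.norm_real, Complex.norm_real, Real.norm_eq_abs,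
    Real.norm_eq_abs]
  linarith

/-- A unital functional of norm at most one is real on self-adjoint elements. -/
theorem im_eq_zero_of_norm_le_one {f : StrongDual ℂ A} (hf : ‖f‖ ≤ 1) (h1 : f 1 = 1) {a : A}
    (ha : IsSelfAdjoint a) : (f a).im = 0 := by
  -- Shift by an imaginary scalar: `‖a + it‖²` is at most `‖a‖² + t²`, while `|f (a + it)|²` is at
  -- least `(Im f a + t)²`. The `t²` cancels, leaving a bound linear in `t`.
  have key : ∀ t : ℝ, 2 * (f a).im * t ≤ ‖a‖ ^ 2 := by
    intro t
    set c : A := a + (t * Complex.I : ℂ) • (1 : A) with hc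
    have hfc : f c = f a + t * Complex.I := by
      rw [hc, map_add, map_smul, h1, smul_eq_mul, mul_one]
    have hcc : star c * c = a * a + ((t ^ 2 : ℝ) : ℂ) • (1 : A) := by
      have hs : star c = a - (t * Complex.I : ℂ) • (1 : A) := by
        rw [hc, star_add, star_smul, ha.star_eq, star_one]
        simp [sub_eq_add_neg]
      rw [hs, hc, sub_mul, mul_add, mul_add, smul_one_mul, mul_smul_one, smul_one_mul, smul_smul]
      have : (t * Complex.I * (t * Complex.I) : ℂ) = -((t ^ 2 : ℝ) : ℂ) := by
        push_cast
        linear_combination (t : ℂ) ^ 2 * Complex.I_sq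
      rw [this, neg_smul]
      abel
    have hone : ‖(1 : A)‖ ≤ 1 := by
      rcases subsingleton_or_nontrivial A with h | h
      · simp [Subsingleton.elim (1 : A) 0]
      · exact CStarRing.norm_one.le
    have hn : ‖c‖ ^ 2 ≤ ‖a‖ ^ 2 + t ^ 2 := by
      rw [sq, ← CStarRing.norm_star_mul_self, hcc]
      refine (norm_add_le _ _).trans (add_le_add ?_ ?_)
      · rw [sq]
        exact norm_mul_le _ _
      · rw [norm_smul, Complex.norm_real, Real.norm_of_nonneg (sq_nonneg t)]
        nlinarith [sq_nonneg t]
    have hle : ‖f c‖ ≤ ‖c‖ := f.le_of_opNorm_le hf c |>.trans (one_mul _).le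
    have h3 : ‖f c‖ ^ 2 ≤ ‖c‖ ^ 2 := by gcongr
    rw [← Complex.normSq_eq_norm_sq, hfc, Complex.normSq_apply] at h3
    simp at h3
    nlinarith [sq_nonneg (f a).re, sq_nonneg (f a).im]
  by_contra hne
  -- This `t` turns the left side of `key` into `‖a‖² + 1`.
  have := key ((‖a‖ ^ 2 + 1) / (2 * (f a).im))
  rw [mul_div_cancel₀ _ (by simpa using hne)] at this
  linarith

/-- A unital functional of norm at most one is a state. -/
theorem star_mul_self_nonneg_of_norm_le_one {f : StrongDual ℂ A} (hf : ‖f‖ ≤ 1) (h1 : f 1 = 1)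
    (b : A) : 0 ≤ f (star b * b) := by
  let _ := CStarAlgebra.spectralOrder A
  have := CStarAlgebra.spectralOrderedRing A
  set a := star b * b with ha
  have hsa : IsSelfAdjoint a := IsSelfAdjoint.star_mul_self b
  have h0 : 0 ≤ a := star_mul_self_nonneg b
  have him := im_eq_zero_of_norm_le_one hf h1 hsa
  -- Since `‖a‖ - a` lies between 0 and `‖a‖`, its norm is at most `‖a‖`; applying `f` gives `‖a‖ -
  -- Re f a ≤ ‖a‖`.
  have hmem : algebraMap ℝ A ‖a‖ - a ∈ Set.Icc 0 (algebraMap ℝ A ‖a‖) :=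
    ⟨sub_nonneg.mpr (IsSelfAdjoint.le_algebraMap_norm_self hsa), sub_le_self _ h0⟩
  have hn := ((CStarAlgebra.mem_Icc_algebraMap_iff_norm_le (norm_nonneg a)).mp hmem).2
  have hone : f (algebraMap ℝ A ‖a‖) = (‖a‖ : ℂ) := by
    rw [IsScalarTower.algebraMap_apply ℝ ℂ A, Algebra.algebraMap_eq_smul_one, map_smul, h1]
    simp
  have hle : ‖f (algebraMap ℝ A ‖a‖ - a)‖ ≤ ‖a‖ :=
    ((f.le_of_opNorm_le hf _).trans (one_mul _).le).trans hn
  rw [map_sub, hone] at hle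
  have := (Complex.re_le_norm _).trans hle
  rw [Complex.sub_re, Complex.ofReal_re] at this
  rw [Complex.le_def]
  exact ⟨by simpa using this, by simpa using him.symm⟩

/-- Every point of the spectrum of a normal element is the value of a state. -/
theorem exists_state_apply_eq {b : A} [IsStarNormal b] {z : ℂ} (hz : z ∈ spectrum ℂ b) :
    ∃ μ : StateSpace A, μ.1 b = z := by
  -- In the commutative C*-algebra generated by `b`, which does not change the spectrum, `z` is the
  -- value of a character. A norm-preserving extension of it to `A` is a state.
  let B := StarAlgebra.elemental ℂ b
  let b' : B := ⟨b, StarAlgebra.elemental.self_mem ℂ b⟩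
  have : IsClosed (B : Set A) := StarAlgebra.elemental.isClosed ℂ b
  have hz' : z ∈ spectrum ℂ b' := by
    rw [StarSubalgebra.spectrum_eq B]
    exact hz
  obtain ⟨φ, hφ⟩ := WeakDual.CharacterSpace.mem_spectrum_iff_exists.mp hz'
  have hone : ‖(1 : A)‖ ≤ 1 := by
    rcases subsingleton_or_nontrivial A with h | h
    · simp [Subsingleton.elim (1 : A) 0]
    · exact CStarRing.norm_one.le
  have hφn : ‖WeakDual.toStrongDual (φ : WeakDual ℂ B)‖ ≤ 1 :=
    (WeakDual.CharacterSpace.norm_le_norm_one φ).trans hone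
  obtain ⟨g, hg, hgn⟩ := exists_extension_norm_eq (𝕜 := ℂ) (E := A)
    (Subalgebra.toSubmodule B.toSubalgebra) (WeakDual.toStrongDual (φ : WeakDual ℂ B))
  have hg1 : g 1 = 1 := (hg (1 : B)).trans (map_one φ)
  refine ⟨⟨StrongDual.toWeakDual g, hg1,
    star_mul_self_nonneg_of_norm_le_one (hgn.le.trans hφn) hg1⟩, ?_⟩
  exact (hg b').trans hφ

/-- Spectral points are values of states, so the spectral radius, which equals the norm here, is 0.
-/
theorem eq_zero_of_isSelfAdjoint_of_states {b : A} (hb : IsSelfAdjoint b)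
    (h : ∀ μ : StateSpace A, μ.1 b = 0) : b = 0 := by
  have := hb.isStarNormal
  have hr : spectralRadius ℂ b = 0 := by
    rw [spectralRadius]
    refine le_antisymm (iSup₂_le fun z hz => ?_) bot_le
    obtain ⟨μ, hμ⟩ := exists_state_apply_eq hz
    rw [← hμ, h μ]
    simp
  rw [hb.spectralRadius_eq_nnnorm] at hr
  simpa using hr

/-- The states of a unital C*-algebra separate its points. -/
theorem eq_zero_of_states {b : A} (h : ∀ μ : StateSpace A, μ.1 b = 0) : b = 0 := by
  have hre : (realPart b : A) = 0 := by
    refine eq_zero_of_isSelfAdjoint_of_states (realPart b).2 fun μ => ?_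
    have := μ.apply_star b
    rw [realPart_apply_coe, ← Complex.coe_smul, map_smul, map_add, this, h μ]
    simp
  have him : (imaginaryPart b : A) = 0 := by
    refine eq_zero_of_isSelfAdjoint_of_states (imaginaryPart b).2 fun μ => ?_
    have := μ.apply_star b
    rw [imaginaryPart_apply_coe, map_smul, ← Complex.coe_smul, map_smul, map_sub, this, h μ]
    simp
  rw [← realPart_add_I_smul_imaginaryPart b, hre, him]
  simp

theorem exists_eq_algebraMap_of_states {a : A} (h : ∀ μ ν : StateSpace A, μ.1 a = ν.1 a) :
    ∃ c : ℂ, a = algebraMap ℂ A c := by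
  rcases isEmpty_or_nonempty (StateSpace A) with he | ⟨⟨μ₀⟩⟩
  -- Without states, as for the zero algebra, separation of points holds vacuously and forces `a =
  -- 0`.
  · exact ⟨0, by rw [map_zero]; exact eq_zero_of_states fun μ => he.elim μ⟩
  · refine ⟨μ₀.1 a, sub_eq_zero.mp (eq_zero_of_states fun μ => ?_)⟩
    rw [map_sub, Algebra.algebraMap_eq_smul_one, map_smul, μ.2.1, h μ μ₀]
    simp

end States

/-! ### The Lip-norm of a separable unital C*-algebra -/

section Separable

variable {A : Type u} [CStarAlgebra A]

/-- The distance on states given by a sequence `d` of elements: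
`∑ 2⁻ⁿ |μ(d n) - ν(d n)| / (1 + ‖d n‖)`. -/
def seqDist (d : ℕ → A) (μ ν : StateSpace A) : ℝ :=
  ∑' n, (1 / 2 : ℝ) ^ n * (‖μ.1 (d n) - ν.1 (d n)‖ / (1 + ‖d n‖))

theorem seqDist_term_nonneg (d : ℕ → A) (μ ν : StateSpace A) (n : ℕ) :
    0 ≤ (1 / 2 : ℝ) ^ n * (‖μ.1 (d n) - ν.1 (d n)‖ / (1 + ‖d n‖)) := by positivity

theorem norm_state_sub_le (μ ν : StateSpace A) (a : A) : ‖μ.1 a - ν.1 a‖ ≤ 4 * ‖a‖ := by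
  refine (norm_sub_le _ _).trans ?_
  linarith [μ.norm_apply_le a, ν.norm_apply_le a]

theorem seqDist_term_le (d : ℕ → A) (μ ν : StateSpace A) (n : ℕ) :
    (1 / 2 : ℝ) ^ n * (‖μ.1 (d n) - ν.1 (d n)‖ / (1 + ‖d n‖)) ≤ (1 / 2 : ℝ) ^ n * 4 := by
  gcongr
  rw [div_le_iff₀ (by positivity)]
  linarith [norm_state_sub_le μ ν (d n)]

theorem summable_half_pow_mul_four : Summable fun n : ℕ => (1 / 2 : ℝ) ^ n * 4 :=
  summable_geometric_two.mul_right 4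

theorem continuous_seqDist (d : ℕ → A) (ν : StateSpace A) :
    Continuous fun μ : StateSpace A => seqDist d μ ν := by
  refine continuous_tsum (fun n => ?_) summable_half_pow_mul_four fun n μ => ?_
  · have : Continuous fun μ : StateSpace A => μ.1 (d n) :=
      (WeakDual.eval_continuous (d n)).comp continuous_subtype_val
    fun_prop
  · rw [Real.norm_of_nonneg (seqDist_term_nonneg d μ ν n)]
    exact seqDist_term_le d μ ν n

theorem seqDist_self (d : ℕ → A) (μ : StateSpace A) : seqDist d μ μ = 0 := by
  simp [seqDist]

theorem seqDist_nonneg (d : ℕ → A) (μ ν : StateSpace A) : 0 ≤ seqDist d μ ν :=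
  tsum_nonneg (seqDist_term_nonneg d μ ν)

theorem norm_sub_le_seqDist (d : ℕ → A) (μ ν : StateSpace A) (n : ℕ) :
    ‖μ.1 (d n) - ν.1 (d n)‖ ≤ (2 ^ n * (1 + ‖d n‖)) * seqDist d μ ν := by
  have hs : Summable fun n => (1 / 2 : ℝ) ^ n * (‖μ.1 (d n) - ν.1 (d n)‖ / (1 + ‖d n‖)) :=
    Summable.of_nonneg_of_le (seqDist_term_nonneg d μ ν) (seqDist_term_le d μ ν)
      summable_half_pow_mul_four
  have h := hs.le_tsum n fun m _ => seqDist_term_nonneg d μ ν m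
  have hpos : 0 < 1 + ‖d n‖ := by positivity
  calc ‖μ.1 (d n) - ν.1 (d n)‖
      = (2 ^ n * (1 + ‖d n‖)) *
          ((1 / 2 : ℝ) ^ n * (‖μ.1 (d n) - ν.1 (d n)‖ / (1 + ‖d n‖))) := by
        rw [one_div, inv_pow]
        field_simp
    _ ≤ _ := by
        gcongr
        exact h

/-- If the sequence is dense, the distance separates states. -/
theorem eq_of_seqDist_eq_zero {d : ℕ → A} (hd : DenseRange d) {μ ν : StateSpace A}
    (h : seqDist d μ ν = 0) : μ = ν := by
  refine Subtype.ext (DFunLike.coe_injective ?_)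
  refine hd.equalizer μ.1.continuous ν.1.continuous (funext fun n => ?_)
  have := norm_sub_le_seqDist d μ ν n
  rw [h, mul_zero] at this
  exact sub_eq_zero.mp (norm_le_zero_iff.mp this)

/-- The smallest Lipschitz constant of `a`, as a function on the states with `seqDist d`. -/
def seqLip (d : ℕ → A) (a : A) : ℝ≥0∞ :=
  ⨆ (μ : StateSpace A) (ν : StateSpace A),
    -- Pairs with `μ = ν` contribute nothing, since `0 / 0 = 0` in `ℝ≥0∞`.
    ‖μ.1 a - ν.1 a‖ₑ / ENNReal.ofReal (seqDist d μ ν)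

theorem seqLip_le {d : ℕ → A} {a : A} {K : ℝ≥0∞}
    (h : ∀ μ ν : StateSpace A, ‖μ.1 a - ν.1 a‖ₑ ≤ K * ENNReal.ofReal (seqDist d μ ν)) :
    seqLip d a ≤ K :=
  iSup₂_le fun μ ν => ENNReal.div_le_of_le_mul (h μ ν)

theorem enorm_sub_le_seqLip {d : ℕ → A} (hd : DenseRange d) (a : A) (μ ν : StateSpace A) :
    ‖μ.1 a - ν.1 a‖ₑ ≤ seqLip d a * ENNReal.ofReal (seqDist d μ ν) := by
  rcases eq_or_ne (seqDist d μ ν) 0 with h | h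
  · rw [eq_of_seqDist_eq_zero hd h]
    simp
  · have hpos : 0 < seqDist d μ ν := lt_of_le_of_ne (seqDist_nonneg d μ ν) h.symm
    rw [← ENNReal.div_le_iff (by simpa using hpos) ENNReal.ofReal_ne_top]
    exact le_iSup₂ (f := fun μ ν : StateSpace A =>
      ‖μ.1 a - ν.1 a‖ₑ / ENNReal.ofReal (seqDist d μ ν)) μ ν

theorem isLipschitzSeminorm_seqLip {d : ℕ → A} (hd : DenseRange d) :
    IsLipschitzSeminorm (seqLip d) where
  add_le a b := by
    refine seqLip_le fun μ ν => ?_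
    rw [map_add, map_add, add_sub_add_comm, add_mul]
    exact (enorm_add_le _ _).trans
      (add_le_add (enorm_sub_le_seqLip hd a μ ν) (enorm_sub_le_seqLip hd b μ ν))
  smul_eq c a := by
    simp only [seqLip, ENNReal.mul_iSup]
    refine iSup_congr fun μ => iSup_congr fun ν => ?_
    rw [map_smul, map_smul, ← smul_sub, enorm_smul, mul_div_assoc]
  star_eq a := by
    simp only [seqLip]
    refine iSup_congr fun μ => iSup_congr fun ν => ?_
    rw [μ.apply_star, ν.apply_star, ← star_sub, ← ofReal_norm, norm_star, ofReal_norm]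
  eq_zero_iff a := by
    constructor
    · intro h
      refine exists_eq_algebraMap_of_states fun μ ν => ?_
      have := enorm_sub_le_seqLip hd a μ ν
      rw [h, zero_mul] at this
      exact sub_eq_zero.mp (enorm_eq_zero.mp (le_antisymm this bot_le))
    · rintro ⟨c, rfl⟩
      refine le_antisymm (seqLip_le fun μ ν => ?_) bot_le
      simp only [Algebra.algebraMap_eq_smul_one, map_smul, μ.2.1, ν.2.1]
      simp
  dense_dom := by
    refine hd.mono ?_
    rintro _ ⟨n, rfl⟩
    refine lt_of_le_of_lt (seqLip_le (K := ENNReal.ofReal (2 ^ n * (1 + ‖d n‖)))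
      fun μ ν => ?_) ENNReal.ofReal_lt_top
    rw [← ENNReal.ofReal_mul (by positivity), ← ofReal_norm]
    exact ENNReal.ofReal_le_ofReal (norm_sub_le_seqDist d μ ν n)

theorem mongeKantorovich_seqLip_le {d : ℕ → A} (hd : DenseRange d) (μ ν : StateSpace A) :
    mongeKantorovich (seqLip d) μ ν ≤ ENNReal.ofReal (seqDist d μ ν) := by
  refine iSup₂_le fun a ha => (enorm_sub_le_seqLip hd a μ ν).trans ?_
  calc _ ≤ 1 * ENNReal.ofReal (seqDist d μ ν) := by gcongr
    _ = _ := one_mul _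

/-- Rescaling `a` by `1 / L a` puts it in the unit ball of `L`. If `L a = 0`, then `a` is a scalar,
on which all states agree. -/
theorem IsLipschitzSeminorm.enorm_sub_le_mongeKantorovich {L : A → ℝ≥0∞}
    (hL : IsLipschitzSeminorm L) {a : A} (ha : L a < ∞) (μ ν : StateSpace A) :
    ‖μ.1 a - ν.1 a‖ₑ ≤ L a * mongeKantorovich L μ ν := by
  rcases eq_or_ne (L a) 0 with h | h
  · obtain ⟨c, rfl⟩ := (hL.eq_zero_iff a).mp h
    simp only [Algebra.algebraMap_eq_smul_one, map_smul, μ.2.1, ν.2.1]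
    simp
  · have ht : (0 : ℝ) < (L a).toReal := ENNReal.toReal_pos h ha.ne
    have hc : ‖(((L a).toReal⁻¹ : ℝ) : ℂ)‖ₑ = (L a)⁻¹ := by
      rw [← ofReal_norm, Complex.norm_real, Real.norm_of_nonneg (by positivity),
        ENNReal.ofReal_inv_of_pos ht, ENNReal.ofReal_toReal ha.ne]
    have h1 : L ((((L a).toReal⁻¹ : ℝ) : ℂ) • a) ≤ 1 := by
      rw [hL.smul_eq, hc, ENNReal.inv_mul_cancel h ha.ne]
    have h2 : ‖μ.1 ((((L a).toReal⁻¹ : ℝ) : ℂ) • a) - ν.1 ((((L a).toReal⁻¹ : ℝ) : ℂ) • a)‖ₑ ≤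
        mongeKantorovich L μ ν := le_iSup₂_of_le _ h1 le_rfl
    rw [map_smul, map_smul, ← smul_sub, enorm_smul, hc] at h2
    calc ‖μ.1 a - ν.1 a‖ₑ = L a * ((L a)⁻¹ * ‖μ.1 a - ν.1 a‖ₑ) := by
          rw [← mul_assoc, ENNReal.mul_inv_cancel h ha.ne, one_mul]
      _ ≤ _ := by gcongr

/-- A map into the state space that is nonexpansive for the Monge-Kantorovich distance of a
Lipschitz seminorm is weak-* continuous. -/
theorem IsLipschitzSeminorm.continuous_of_mongeKantorovich_le {L : A → ℝ≥0∞}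
    (hL : IsLipschitzSeminorm L) {Y : Type*} [PseudoEMetricSpace Y] (f : Y → StateSpace A)
    (hf : ∀ x y, mongeKantorovich L (f x) (f y) ≤ edist x y) : Continuous f := by
  refine Continuous.subtype_mk (f := fun y => (f y).1)
    (WeakDual.continuous_of_continuous_eval fun a => ?_) _
  -- Evaluation at `a` is a uniform limit of evaluations at elements of finite seminorm; the `ε / 2`
  -- below absorbs the factor 2 in `norm_apply_le`.
  refine continuous_of_uniform_approx_of_continuous fun u hu => ?_
  obtain ⟨ε, hε, hu⟩ := Metric.mem_uniformity_dist.mp hu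
  obtain ⟨b, hb, hab⟩ := Metric.dense_iff.mp hL.dense_dom a (ε / 2) (by positivity)
  refine ⟨fun y => (f y).1 b, ?_, fun y => hu ?_⟩
  · have : LipschitzWith (L b).toNNReal fun y => (f y).1 b := by
      intro x y
      rw [edist_eq_enorm_sub, ENNReal.coe_toNNReal (ne_of_lt hab)]
      refine (hL.enorm_sub_le_mongeKantorovich hab _ _).trans ?_
      gcongr
      exact hf x y
    exact this.continuous
  · rw [dist_eq_norm, ← map_sub]
    refine ((f y).norm_apply_le _).trans_lt ?_
    have h : ‖a - b‖ < ε / 2 := by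
      rw [← dist_eq_norm, dist_comm]
      exact hb
    linarith

theorem isLipNorm_seqLip {d : ℕ → A} (hd : DenseRange d) : IsLipNorm (seqLip d) where
  toIsLipschitzSeminorm := isLipschitzSeminorm_seqLip hd
  topology_eq := by
    -- Here `≤` means finer: first the metric topology refines the weak-* one, then the reverse,
    -- checked at each state.
    refine le_antisymm ?_ (le_of_nhds_le_nhds fun μ => ?_)
    · rw [← continuous_id_iff_le]
      exact @IsLipschitzSeminorm.continuous_of_mongeKantorovich_le A _ _
        (isLipschitzSeminorm_seqLip hd) _ (mongeKantorovichSpace (seqLip d)) id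
        fun _ _ => le_rfl
    · refine (@EMetric.tendsto_nhds _ _ (mongeKantorovichSpace (seqLip d)) _ id μ).mpr
        fun ε hε => ?_
      have h : Filter.Tendsto (fun ν => ENNReal.ofReal (seqDist d ν μ)) (𝓝 μ) (𝓝 0) := by
        have := ENNReal.tendsto_ofReal ((continuous_seqDist d μ).tendsto μ)
        rwa [seqDist_self, ENNReal.ofReal_zero] at this
      filter_upwards [h.eventually_lt_const hε] with ν hν
      exact (mongeKantorovich_seqLip_le hd ν μ).trans_lt hν

/-- Every separable unital C*-algebra admits the structure of a compact quantum metric space. -/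
theorem admitsCompactQuantumMetric_of_separable [TopologicalSpace.SeparableSpace A] :
    AdmitsCompactQuantumMetric A := by
  obtain ⟨d, hd⟩ := TopologicalSpace.exists_dense_seq A
  exact ⟨seqLip d, isLipNorm_seqLip hd⟩

end Separable

/-! ### Separability of inductive limits -/

theorem separableSpace_of_dense_iUnion {A : Type u} [TopologicalSpace A] {S : ℕ → Set A}
    (hS : ∀ n, TopologicalSpace.IsSeparable (S n)) (hd : Dense (⋃ n, S n)) :
    TopologicalSpace.SeparableSpace A := by
  rw [← TopologicalSpace.isSeparable_univ_iff, ← hd.closure_eq]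
  exact (TopologicalSpace.IsSeparable.iUnion hS).closure

/-- Each `ψ n` is contractive, so its range is separable. -/
theorem IsInductiveLimit.separableSpace {B : ℕ → Type v} [∀ n, CStarAlgebra (B n)]
    [∀ n, TopologicalSpace.SeparableSpace (B n)]
    {φ : ∀ n, B n →⋆ₐ[ℂ] B (n + 1)} {A : Type u} [CStarAlgebra A]
    {ψ : ∀ n, B n →⋆ₐ[ℂ] A} (h : IsInductiveLimit φ ψ) :
    TopologicalSpace.SeparableSpace A :=
  separableSpace_of_dense_iUnion
    (fun n => TopologicalSpace.isSeparable_range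
      (AddMonoidHomClass.continuous_of_bound (ψ n) 1 fun x =>
        (NonUnitalStarAlgHom.norm_apply_le (ψ n) x).trans (one_mul _).ge)) h.dense

/-- The topology of `CStarMatrix` is definitionally the entrywise product topology. -/
instance CStarMatrix.separableSpace {k : ℕ} {R : Type*} [NonUnitalCStarAlgebra R]
    [PartialOrder R] [StarOrderedRing R] [TopologicalSpace.SeparableSpace R] :
    TopologicalSpace.SeparableSpace (CStarMatrix (Fin k) (Fin k) R) :=
  inferInstanceAs (TopologicalSpace.SeparableSpace (Fin k → Fin k → R))

theorem IsUHF.separableSpace {A : Type u} [CStarAlgebra A] (h : IsUHF A) :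
    TopologicalSpace.SeparableSpace A := by
  obtain ⟨k, -, φ, ψ, h⟩ := h
  exact h.separableSpace

theorem IsBunceDeddens.separableSpace {A : Type u} [CStarAlgebra A] (h : IsBunceDeddens A) :
    TopologicalSpace.SeparableSpace A := by
  obtain ⟨k₀, m, -, -, ψ, h⟩ := h
  exact h.separableSpace

theorem IsAF.separableSpace {A : Type u} [CStarAlgebra A] (h : IsAF A) :
    TopologicalSpace.SeparableSpace A := by
  obtain ⟨S, -, hfin, hd⟩ := h
  refine separableSpace_of_dense_iUnion (fun n => ?_) hd
  have := hfin n
  have : FiniteDimensional ℂ (S n).toSubmodule := hfin n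
  -- A finite-dimensional normed space is proper, hence separable.
  have : ProperSpace (S n).toSubmodule := FiniteDimensional.proper ℂ _
  simpa using TopologicalSpace.isSeparable_range
    (continuous_subtype_val (p := fun x => x ∈ (S n).toSubmodule))

end QuantumMetric

end

theorem corollary3p7 (A : Type*) [CStarAlgebra A] :
    (QuantumMetric.IsUHF A → QuantumMetric.AdmitsCompactQuantumMetric A) ∧
    (QuantumMetric.IsAF A → QuantumMetric.AdmitsCompactQuantumMetric A) ∧
    (QuantumMetric.IsBunceDeddens A → QuantumMetric.AdmitsCompactQuantumMetric A) := by
  refine ⟨fun h => ?_, fun h => ?_, fun h => ?_⟩ <;>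
  · have := h.separableSpace
    exact QuantumMetric.admitsCompactQuantumMetric_of_separable
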